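/- Conventions. A hypergraph $H=(V,E)$ has a finite nonempty vertex set $V$ and a set $E$ of nonempty subsets of $V$ (edges); $v(H)=|V|$ and $e_r(H)$ is the number of edges of size $r$. A hypergraph $H'=(V',E')$ is a strong subgraph of $H$ if $V'\subseteq V$ and $E'\subseteq E$; it is a weak subgraph of $H$ if $V'\subseteq V$ and $E'\subseteq\{e\cap V' : e\in E\}\setminus\{\emptyset\}$. A weak copy of $H$ in a hypergraph $G$ is a weak subgraph of $G$ isomorphic to $H$. Given $\mathbf p=(p_r)_{r\ge 1}$ with $p_r=p_r(n)\in[0,1]$, the random hypergraph $\mathscr H(n,\mathbf p)$ has vertex set $\{1,\dots,n\}$, and each nonempty set $e$ of vertices is an edge independently with probability $p_{|e|}$. Asymptotically almost surely (a.a.s.) means with probability tending to $1$ as $n\to\infty$. Theorem. Let $H$ be a fixed hypergraph, let $M\ge 0$ be a fixed integer, and let $\mathbf p=(p_r)_{r\ge1}$ be $M$-bounded, i.e. $p_r(n)=0$ for all $n$ and all $r>M$. For $r\ge 1$ put $$p'_r=\sum_{i=0}^{M-r} n^i\,p_{r+i}\quad(\text{so } p'_r=0 \text{ if } r>M),$$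 and for each hypergraph $H'$ put $$\mu_w(H')=n^{v(H')}\prod_{r\ge1}(p'_r)^{e_r(H')},\qquad 0^0=1 .$$ (a) If $\mu_w(H')\to0$ as $n\to\infty$ for some strong subgraph $H'$ of $H$, then a.a.s. $\mathscr H(n,\mathbf p)$ contains no weak copy of $H$. (b) If $\mu_w(H')\to\infty$ as $n\to\infty$ for every strong subgraph $H'$ of $H$, then a.a.s. $\mathscr H(n,\mathbf p)$ contains a weak copy of $H$. -/

import Mathlib

open Filter Topology MeasureTheory unitInterval

noncomputable section

namespace Hypergraph

variable {α β : Type*}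

/-- `H'` is a strong subhypergraph of `H`: `V(H') ⊆ V(H)` and `E(H') ⊆ E(H)`. -/
def IsStrongSubhypergraph (H' H : Hypergraph α) : Prop :=
  H'.vertexSet ⊆ H.vertexSet ∧ H'.edgeSet ⊆ H.edgeSet

/-- `H'` is a weak subhypergraph of `H`: `V' ⊆ V` and `E' ⊆ {e ∩ V' : e ∈ E} \ {∅}`. -/
def IsWeakSubhypergraph (H' H : Hypergraph α) : Prop :=
  H'.vertexSet ⊆ H.vertexSet ∧
    H'.edgeSet ⊆ {f : Set α | ∃ e ∈ H.edgeSet, f = e ∩ H'.vertexSet} \ {∅}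

/-- Isomorphism of hypergraphs: a bijection of the vertex sets under which a set of vertices
is an edge if and only if its image is an edge. -/
def Isomorphic (H : Hypergraph α) (K : Hypergraph β) : Prop :=
  ∃ φ : H.vertexSet ≃ K.vertexSet, ∀ s : Set H.vertexSet,
    (Subtype.val '' s ∈ H.edgeSet ↔ Subtype.val '' (φ '' s) ∈ K.edgeSet)

/-- `G` contains a weak copy of `H`: a weak subhypergraph of `G` isomorphic to `H`. -/
def ContainsWeakCopy (G : Hypergraph β) (H : Hypergraph α) : Prop :=
  ∃ K : Hypergraph β, K.IsWeakSubhypergraph G ∧ H.Isomorphic K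

/-- `v(H)`, the number of vertices. -/
def numVertices (H : Hypergraph α) : ℕ := H.vertexSet.ncard

/-- `e_r(H)`, the number of edges of size `r`. -/
def numEdges (H : Hypergraph α) (r : ℕ) : ℕ := {e ∈ H.edgeSet | e.ncard = r}.ncard

/-- `p'_r = p_r + n p_{r+1} + ⋯ + n^{M-r} p_M`, an empty sum (hence `0`) when `r > M`. -/
def pPrime (M n : ℕ) (p : ℕ → I) (r : ℕ) : ℝ :=
  ∑ j ∈ Finset.Icc r M, (n : ℝ) ^ (j - r) * (p j : ℝ)

/-- `μ_w(H) = n^{v(H)} ∏_{r ≥ 1} (p'_r)^{e_r(H)}`. The product runs over `1 ≤ r ≤ v(H)` because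
a finite hypergraph has no edge with more than `v(H)` vertices. -/
def muW (M n : ℕ) (p : ℕ → I) (H : Hypergraph α) : ℝ :=
  (n : ℝ) ^ H.numVertices *
    ∏ r ∈ Finset.Icc 1 H.numVertices, pPrime M n p r ^ H.numEdges r

/-- The law of independent coins, one for each set `s` of labelled vertices, where the coin of `s`
shows `true` with probability `p_{|s|}`. -/
def coinMeasure (n : ℕ) (p : ℕ → I) : Measure (Finset (Fin n) → Bool) :=
  Measure.pi fun s => ProbabilityTheory.bernoulliMeasure true false (p s.card)

/-- The random hypergraph `ℋ(n, p)` as a function of the coins `ω`: all `n` labelled vertices, and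
as edges the nonempty sets of vertices whose coin shows `true`. -/
def random (n : ℕ) (ω : Finset (Fin n) → Bool) : Hypergraph (Fin n) where
  vertexSet := Set.univ
  edgeSet := {e | ∃ s : Finset (Fin n), s.Nonempty ∧ ω s = true ∧ e = (s : Set (Fin n))}
  subset_vertexSet_of_mem_edgeSet' := fun _ _ => Set.subset_univ _

/-- The property `A` holds asymptotically almost surely for `ℋ(n, p)`, where `p n r = p_r(n)`. -/
def HoldsAAS (p : ℕ → ℕ → I) (A : ∀ n : ℕ, Hypergraph (Fin n) → Prop) : Prop :=
  Tendsto (fun n => (coinMeasure n (p n)).real {ω | A n (random n ω)}) atTop (𝓝 1)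

end Hypergraph

end

/-!
A weak copy of `H` in a hypergraph on `n` labelled vertices is the same as an injection `φ` of
`V(H)` into the labelled vertices such that every edge `f` of `H` has a witness: an edge `e` of
the hypergraph with `e ∩ φ(V(H)) = φ(f)`. The pairs of an injection and a choice of such sets `e`,
whether or not they are edges, are the `placements` of `H`. Different edges of `H` have different
witnesses, so a placement occurs with probability `∏ p_{|e|}`. Given `φ`, the sum of `p_{|e|}`
over the candidates `e` for an edge of size `r` is `p'_r` up to a constant factor
(`sum_superset_le_pPrime` and `pPrime_div_le_sum_inter_eq`), so the expected number of placements
of `H'` that occur is `μ_w(H')` up to a constant factor.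

For absence, a weak copy of `H` restricts to a weak copy of the strong subhypergraph `H'`, and the
expected number of those tends to `0` (`coinMeasure_real_exists_placement_le`).

For existence, the second moment method is applied to the number of placements that occur. Fix a
placement `c`, and sort the placements `c'` by the set `F` of edges of `H` whose witness in `c'`
is also a witness in `c`. If `F` is empty, the two placements are independent. Otherwise the
vertices covered by `F` go into the bounded set of labelled vertices that the witnesses of `c`
cover, so compared with the full expectation a factor `n` is lost for each of these vertices and a
factor `p'_{|f|}` for each `f ∈ F`; this is the factor `μ_w` of the subhypergraph formed by `F`
and the vertices that it covers (`sum_placements_overlap_le`). Therefore the probability that `H`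
has no weak copy is at most a constant times the sum of `1 / μ_w` over these subhypergraphs
(`coinMeasure_real_forall_notMem_placement_le`).
-/

/-! ### Independent coins and the second moment method -/

namespace Hypergraph

instance (n : ℕ) (p : ℕ → I) : IsProbabilityMeasure (coinMeasure n p) := by
  unfold coinMeasure; infer_instance

theorem coinMeasure_real_forall_eq_true (n : ℕ) (p : ℕ → I) (S : Finset (Finset (Fin n))) :
    (coinMeasure n p).real {ω | ∀ s ∈ S, ω s = true} = ∏ s ∈ S, (p s.card : ℝ) := by
  have h : {ω : Finset (Fin n) → Bool | ∀ s ∈ S, ω s = true} =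
      Set.pi (S : Set (Finset (Fin n))) fun _ => {true} := by
    ext ω; simp [Set.mem_pi]
  rw [measureReal_def, coinMeasure, h, Measure.pi_pi_finset, ENNReal.toReal_prod]
  refine Finset.prod_congr rfl fun s _ => ?_
  rw [← measureReal_def]
  exact ProbabilityTheory.bernoulliMeasure_real_apply_of_mem_of_notMem _
    (MeasurableSet.singleton _) (by simp) (by simp)

end Hypergraph

/-- Chebyshev's inequality for the number of events `A c` that occur: `m` is its mean and `D` bounds
its variance. -/
theorem sq_mul_measureReal_forall_notMem_le {Ω κ : Type*} [MeasurableSpace Ω] (P : Measure Ω)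
    [IsProbabilityMeasure P] (C : Finset κ) (A : κ → Set Ω) (hA : ∀ c, MeasurableSet (A c))
    {m D : ℝ} (hm : ∑ c ∈ C, P.real (A c) = m)
    (hD : ∑ c ∈ C, ∑ c' ∈ C, P.real (A c ∩ A c') ≤ m ^ 2 + D) :
    m ^ 2 * P.real {ω | ∀ c ∈ C, ω ∉ A c} ≤ D := by
  classical
  set X : Ω → ℝ := fun ω => ∑ c ∈ C, (A c).indicator 1 ω with hX
  have hi : ∀ B : Set Ω, MeasurableSet B → Integrable (B.indicator (1 : Ω → ℝ)) P := fun B hB =>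
    (integrable_const (1 : ℝ)).indicator hB
  have hX1 : Integrable X P := integrable_finsetSum _ fun c _ => hi _ (hA c)
  have hXX : ∀ ω, X ω ^ 2 = ∑ c ∈ C, ∑ c' ∈ C, (A c ∩ A c').indicator (1 : Ω → ℝ) ω := by
    intro ω
    simp only [hX, sq, Finset.sum_mul_sum, Set.inter_indicator_one, Pi.mul_apply]
  have hX2 : Integrable (fun ω => X ω ^ 2) P := by
    simp only [hXX]
    exact integrable_finsetSum _ fun c _ => integrable_finsetSum _ fun c' _ =>
      hi _ ((hA c).inter (hA c'))
  have e1 : ∫ ω, X ω ∂P = m := by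
    rw [← hm, integral_finsetSum _ fun c _ => hi _ (hA c)]
    exact Finset.sum_congr rfl fun c _ => integral_indicator_one (hA c)
  have e2 : ∫ ω, X ω ^ 2 ∂P ≤ m ^ 2 + D := by
    refine le_trans (le_of_eq ?_) hD
    simp only [hXX]
    rw [integral_finsetSum _ fun c _ => integrable_finsetSum _ fun c' _ =>
      hi _ ((hA c).inter (hA c'))]
    refine Finset.sum_congr rfl fun c _ => ?_
    rw [integral_finsetSum _ fun c' _ => hi _ ((hA c).inter (hA c'))]
    exact Finset.sum_congr rfl fun c' _ => integral_indicator_one ((hA c).inter (hA c'))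
  set B : Set Ω := {ω | ∀ c ∈ C, ω ∉ A c} with hB
  have hBm : MeasurableSet B := by
    have : B = ⋂ c ∈ C, (A c)ᶜ := by ext ω; simp [hB]
    rw [this]
    exact Finset.measurableSet_biInter _ fun c _ => (hA c).compl
  have hlin : Integrable (fun ω => X ω ^ 2 - 2 * m * X ω + m ^ 2) P :=
    (hX2.sub (hX1.const_mul _)).add (integrable_const _)
  have hle : ∀ ω, m ^ 2 * B.indicator (1 : Ω → ℝ) ω ≤ X ω ^ 2 - 2 * m * X ω + m ^ 2 := by
    intro ω
    by_cases h : ω ∈ B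
    · have : X ω = 0 := Finset.sum_eq_zero fun c hc => Set.indicator_of_notMem (h c hc) _
      simp [h, this]
    · simp only [h, not_false_eq_true, Set.indicator_of_notMem, mul_zero]
      nlinarith [sq_nonneg (X ω - m)]
  calc m ^ 2 * P.real B = ∫ ω, m ^ 2 * B.indicator (1 : Ω → ℝ) ω ∂P := by
        rw [integral_const_mul, integral_indicator_one hBm]
    _ ≤ ∫ ω, (X ω ^ 2 - 2 * m * X ω + m ^ 2) ∂P :=
        integral_mono ((hi B hBm).const_mul _) hlin hle
    _ = ∫ ω, X ω ^ 2 ∂P - 2 * m * m + m ^ 2 := by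
        have hs : Integrable (fun ω => X ω ^ 2 - 2 * m * X ω) P := hX2.sub (hX1.const_mul _)
        rw [integral_add hs (integrable_const _), integral_sub hX2 (hX1.const_mul _),
          integral_const_mul, e1]
        simp
    _ ≤ D := by nlinarith

/-! ### Counting the sets with a prescribed trace -/

namespace Hypergraph

theorem pPrime_nonneg (M n : ℕ) (p : ℕ → I) (r : ℕ) : 0 ≤ pPrime M n p r :=
  Finset.sum_nonneg fun j _ => mul_nonneg (by positivity) (p j).2.1

theorem card_filter_superset_le {n : ℕ} (A : Finset (Fin n)) (j : ℕ) :
    ((Finset.univ.filter fun e : Finset (Fin n) => A ⊆ e ∧ e.card = j).card : ℕ)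
      ≤ n ^ (j - A.card) := by
  calc _ ≤ (Finset.powersetCard (j - A.card) (Finset.univ : Finset (Fin n))).card := by
        refine Finset.card_le_card_of_injOn (fun e => e \ A) ?_ ?_
        · intro e he
          simp only [Finset.coe_filter, Finset.mem_univ, true_and, Set.mem_ofPred_eq] at he
          simp [Finset.mem_powersetCard, Finset.card_sdiff_of_subset he.1, he.2]
        · intro e he e' he' h
          simp only [Finset.coe_filter, Finset.mem_univ, true_and, Set.mem_ofPred_eq] at he he'
          rw [← Finset.sdiff_union_of_subset he.1, ← Finset.sdiff_union_of_subset he'.1]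
          simp only at h
          rw [h]
    _ ≤ n ^ (j - A.card) := by
        rw [Finset.card_powersetCard, Finset.card_univ, Fintype.card_fin]
        exact Nat.choose_le_pow _ _

theorem sum_superset_le_pPrime {M n : ℕ} {p : ℕ → I} (hp : ∀ r, M < r → p r = 0)
    (A : Finset (Fin n)) :
    ∑ e ∈ Finset.univ.filter (fun e : Finset (Fin n) => A ⊆ e), (p e.card : ℝ)
      ≤ pPrime M n p A.card := by
  have h1 : ∑ e ∈ Finset.univ.filter (fun e : Finset (Fin n) => A ⊆ e), (p e.card : ℝ) =
      ∑ e ∈ Finset.univ.filter (fun e : Finset (Fin n) => A ⊆ e ∧ e.card ≤ M),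
        (p e.card : ℝ) := by
    symm
    refine Finset.sum_subset (fun e => by simp +contextual) fun e he he' => ?_
    simp only [Finset.mem_filter, Finset.mem_univ, true_and] at he he'
    simp [hp e.card (by by_contra h; exact he' ⟨he, by omega⟩)]
  rw [h1, ← Finset.sum_fiberwise_of_maps_to (s := Finset.univ.filter
    (fun e : Finset (Fin n) => A ⊆ e ∧ e.card ≤ M)) (t := Finset.Icc A.card M)
    (g := Finset.card), pPrime]
  · refine Finset.sum_le_sum fun j _ => ?_
    rw [Finset.sum_congr rfl (g := fun _ => (p j : ℝ)) (fun e he => by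
      rw [(Finset.mem_filter.1 he).2]), Finset.sum_const, nsmul_eq_mul]
    refine mul_le_mul_of_nonneg_right ?_ (p j).2.1
    refine le_trans (Nat.cast_le.2 (le_trans (Finset.card_le_card ?_)
      (card_filter_superset_le A j))) (by push_cast; rfl)
    intro e
    simp only [Finset.mem_filter, Finset.mem_univ, true_and]
    tauto
  · intro e
    simp only [Finset.mem_filter, Finset.mem_univ, true_and, Finset.mem_Icc]
    exact fun h => ⟨Finset.card_le_card h.1, h.2⟩

theorem choose_le_card_filter_inter_eq {n : ℕ} {A W : Finset (Fin n)} (hAW : A ⊆ W) {j : ℕ}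
    (hj : A.card ≤ j) :
    (n - W.card).choose (j - A.card) ≤
      (Finset.univ.filter fun e : Finset (Fin n) => e ∩ W = A ∧ e.card = j).card := by
  have hd : ∀ e : Finset (Fin n), e ⊆ Wᶜ → Disjoint e W := fun e he =>
    Finset.disjoint_of_subset_left he disjoint_compl_left
  calc (n - W.card).choose (j - A.card) = (Finset.powersetCard (j - A.card) Wᶜ).card := by
        rw [Finset.card_powersetCard, Finset.card_compl, Fintype.card_fin]
    _ ≤ _ := by
        refine Finset.card_le_card_of_injOn (fun e => e ∪ A) ?_ ?_
        · intro e he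
          simp only [SetLike.mem_coe, Finset.mem_powersetCard] at he
          have h1 := hd e he.1
          simp only [Finset.coe_filter, Finset.mem_univ, true_and, Set.mem_ofPred_eq]
          refine ⟨?_, ?_⟩
          · rw [Finset.union_inter_distrib_right, Finset.disjoint_iff_inter_eq_empty.1 h1,
              Finset.empty_union, Finset.inter_eq_left.2 hAW]
          · rw [Finset.card_union_of_disjoint (Finset.disjoint_of_subset_right hAW h1), he.2]
            omega
        · intro e he e' he' h
          simp only [SetLike.mem_coe, Finset.mem_powersetCard] at he he'
          have h1 := Finset.disjoint_of_subset_right hAW (hd e he.1)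
          have h2 := Finset.disjoint_of_subset_right hAW (hd e' he'.1)
          rw [← Finset.union_sdiff_cancel_right h1, ← Finset.union_sdiff_cancel_right h2]
          simp only at h
          rw [h]

theorem div_le_choose_sub {n w i M : ℕ} (hi : i ≤ M) (hn : 2 * (w + M) ≤ n) :
    (n : ℝ) ^ i / (2 ^ M * M.factorial) ≤ ((n - w).choose i : ℝ) := by
  refine le_trans ?_ (Nat.pow_le_choose (α := ℝ) i (n - w))
  have h1 : ((n : ℝ) / 2) ≤ ((n - w + 1 - i : ℕ) : ℝ) := by
    have : n ≤ 2 * (n - w + 1 - i) := by omega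
    have : (n : ℝ) ≤ 2 * ((n - w + 1 - i : ℕ) : ℝ) := by exact_mod_cast this
    linarith
  have h2 : ((n : ℝ) / 2) ^ i ≤ ((n - w + 1 - i : ℕ) : ℝ) ^ i :=
    pow_le_pow_left₀ (by positivity) h1 _
  have h3 : ((i.factorial : ℕ) : ℝ) ≤ M.factorial := by
    exact_mod_cast Nat.factorial_le hi
  have h4 : (2 : ℝ) ^ i ≤ 2 ^ M := pow_le_pow_right₀ (by norm_num) hi
  calc (n : ℝ) ^ i / (2 ^ M * M.factorial) ≤ (n : ℝ) ^ i / (2 ^ i * i.factorial) := by gcongr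
    _ = ((n : ℝ) / 2) ^ i / i.factorial := by rw [div_pow, div_div]
    _ ≤ _ := by gcongr

/-- The expected number of edges with a prescribed trace of size `r` on a bounded set of vertices is
at least a constant times `p'_r`, since the bounded set leaves at least `n / 2` vertices. -/
theorem pPrime_div_le_sum_inter_eq {M n : ℕ} (p : ℕ → I) {A W : Finset (Fin n)} (hAW : A ⊆ W)
    (hn : 2 * (W.card + M) ≤ n) :
    pPrime M n p A.card / (2 ^ M * M.factorial) ≤
      ∑ e ∈ Finset.univ.filter (fun e : Finset (Fin n) => e ∩ W = A ∧ e.card ≤ M),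
        (p e.card : ℝ) := by
  rw [← Finset.sum_fiberwise_of_maps_to (s := Finset.univ.filter
    (fun e : Finset (Fin n) => e ∩ W = A ∧ e.card ≤ M)) (t := Finset.Icc A.card M)
    (g := Finset.card), pPrime, Finset.sum_div]
  · refine Finset.sum_le_sum fun j hj => ?_
    rw [Finset.mem_Icc] at hj
    rw [Finset.sum_congr rfl (g := fun _ => (p j : ℝ)) (fun e he => by
      rw [(Finset.mem_filter.1 he).2]), Finset.sum_const, nsmul_eq_mul, mul_div_right_comm]
    refine mul_le_mul_of_nonneg_right ?_ (p j).2.1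
    refine (div_le_choose_sub (w := W.card) (by omega) hn).trans (Nat.cast_le.2
      ((choose_le_card_filter_inter_eq hAW hj.1).trans (Finset.card_le_card ?_)))
    intro e
    simp only [Finset.mem_filter, Finset.mem_univ, true_and]
    rintro ⟨h, rfl⟩
    exact ⟨⟨h, hj.2⟩, rfl⟩
  · intro e
    simp only [Finset.mem_filter, Finset.mem_univ, true_and, Finset.mem_Icc]
    rintro ⟨rfl, h⟩
    exact ⟨Finset.card_le_card Finset.inter_subset_left, h⟩

end Hypergraph

/-! ### Placements and the first moment -/

namespace Hypergraph

variable {V ι : Type*} [Fintype V] [Fintype ι] [DecidableEq ι]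

/-- A placement of the hypergraph on `V` with edges `g i` consists of an injection `φ` of `V` into
the `n` labelled vertices and, for every `i`, a set of at most `N` labelled vertices whose trace
on the image of `φ` is the image of `g i`. A weak copy is a placement all of whose sets are edges.
The bound `N` is the largest size of an edge when the sets of a placement must cover boundedly
many vertices, and `n` when it should not be a restriction. -/
noncomputable def placements (g : ι → Finset V) (n N : ℕ) :
    Finset (Σ _ : V ↪ Fin n, ι → Finset (Fin n)) :=
  Finset.univ.sigma fun φ => Fintype.piFinset fun i =>
    Finset.univ.filter fun e => e ∩ Finset.univ.map φ = (g i).map φ ∧ e.card ≤ N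

variable {g : ι → Finset V} {n N : ℕ}

theorem mem_placements {c : Σ _ : V ↪ Fin n, ι → Finset (Fin n)} :
    c ∈ placements g n N ↔
      ∀ i, c.2 i ∩ Finset.univ.map c.1 = (g i).map c.1 ∧ (c.2 i).card ≤ N := by
  simp [placements, Fintype.mem_piFinset]

theorem map_subset_of_mem_placements {c : Σ _ : V ↪ Fin n, ι → Finset (Fin n)}
    (hc : c ∈ placements g n N) (i : ι) : (g i).map c.1 ⊆ c.2 i :=
  (mem_placements.1 hc i).1 ▸ Finset.inter_subset_left

/-- Different edges have different traces, so they are witnessed by different sets. -/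
theorem injective_of_mem_placements (hg : Function.Injective g)
    {c : Σ _ : V ↪ Fin n, ι → Finset (Fin n)} (hc : c ∈ placements g n N) :
    Function.Injective c.2 := by
  intro i j hij
  have h := (mem_placements.1 hc i).1
  rw [hij, (mem_placements.1 hc j).1] at h
  exact (hg (Finset.map_injective _ h)).symm

/-- The event that all the sets of a placement are edges. -/
def placementEvent (c : Σ _ : V ↪ Fin n, ι → Finset (Fin n)) : Set (Finset (Fin n) → Bool) :=
  {ω | ∀ i, ω (c.2 i) = true}

theorem coinMeasure_real_placementEvent (hg : Function.Injective g) (p : ℕ → I)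
    {c : Σ _ : V ↪ Fin n, ι → Finset (Fin n)} (hc : c ∈ placements g n N) :
    (coinMeasure n p).real (placementEvent c) = ∏ i, (p (c.2 i).card : ℝ) := by
  have h := coinMeasure_real_forall_eq_true n p (Finset.univ.image c.2)
  rw [Finset.prod_image (injective_of_mem_placements hg hc).injOn] at h
  rw [← h]
  congr 1
  ext ω
  simp [placementEvent]

theorem sum_placements_prod (g : ι → Finset V) (n N : ℕ) (p : ℕ → I) :
    ∑ c ∈ placements g n N, ∏ i, (p (c.2 i).card : ℝ) =
      ∑ φ : V ↪ Fin n, ∏ i, ∑ e ∈ Finset.univ.filter (fun e : Finset (Fin n) =>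
        e ∩ Finset.univ.map φ = (g i).map φ ∧ e.card ≤ N), (p e.card : ℝ) := by
  rw [placements, Finset.sum_sigma]
  refine Finset.sum_congr rfl fun φ _ => ?_
  rw [Finset.prod_univ_sum]

theorem sum_placements_prod_le {M : ℕ} {p : ℕ → I} (hp : ∀ r, M < r → p r = 0)
    (g : ι → Finset V) (n N : ℕ) :
    ∑ c ∈ placements g n N, ∏ i, (p (c.2 i).card : ℝ) ≤
      (n : ℝ) ^ Fintype.card V * ∏ i, pPrime M n p (g i).card := by
  rw [sum_placements_prod]
  have h1 : ∀ φ : V ↪ Fin n, ∏ i, ∑ e ∈ Finset.univ.filter (fun e : Finset (Fin n) =>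
        e ∩ Finset.univ.map φ = (g i).map φ ∧ e.card ≤ N), (p e.card : ℝ) ≤
      ∏ i, pPrime M n p (g i).card := by
    intro φ
    refine Finset.prod_le_prod (fun i _ => Finset.sum_nonneg fun e _ => (p e.card).2.1)
      fun i _ => ?_
    rw [← Finset.card_map φ]
    refine le_trans (Finset.sum_le_sum_of_subset_of_nonneg ?_ fun e _ _ => (p e.card).2.1)
      (sum_superset_le_pPrime hp ((g i).map φ))
    intro e
    simp only [Finset.mem_filter, Finset.mem_univ, true_and]
    exact fun h => h.1 ▸ Finset.inter_subset_left
  refine (Finset.sum_le_sum fun φ _ => h1 φ).trans ?_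
  rw [Finset.sum_const, nsmul_eq_mul]
  refine mul_le_mul_of_nonneg_right ?_ (Finset.prod_nonneg fun i _ => pPrime_nonneg _ _ _ _)
  rw [Finset.card_univ, Fintype.card_embedding_eq, Fintype.card_fin]
  exact_mod_cast Nat.descFactorial_le_pow _ _

theorem le_sum_placements_prod {M : ℕ} (p : ℕ → I) (g : ι → Finset V)
    (hn : 2 * (Fintype.card V + M) ≤ n) :
    (n : ℝ) ^ Fintype.card V * (∏ i, pPrime M n p (g i).card) /
        (2 ^ Fintype.card V * (2 ^ M * M.factorial) ^ Fintype.card ι) ≤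
      ∑ c ∈ placements g n M, ∏ i, (p (c.2 i).card : ℝ) := by
  rw [sum_placements_prod]
  have h1 : ∀ φ : V ↪ Fin n, (∏ i, pPrime M n p (g i).card) /
        (2 ^ M * M.factorial) ^ Fintype.card ι ≤
      ∏ i, ∑ e ∈ Finset.univ.filter (fun e : Finset (Fin n) =>
        e ∩ Finset.univ.map φ = (g i).map φ ∧ e.card ≤ M), (p e.card : ℝ) := by
    intro φ
    rw [← Finset.card_univ, ← Finset.prod_const, ← Finset.prod_div_distrib]
    refine Finset.prod_le_prod (fun i _ => div_nonneg (pPrime_nonneg _ _ _ _) (by positivity))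
      fun i _ => ?_
    rw [← Finset.card_map φ]
    exact pPrime_div_le_sum_inter_eq p (Finset.map_subset_map.2 (Finset.subset_univ _))
      (by simpa using hn)
  refine le_trans ?_ (Finset.sum_le_sum fun φ _ => h1 φ)
  rw [Finset.sum_const, nsmul_eq_mul, mul_div_mul_comm]
  refine mul_le_mul_of_nonneg_right ?_ (div_nonneg
    (Finset.prod_nonneg fun i _ => pPrime_nonneg _ _ _ _) (by positivity))
  rw [Finset.card_univ, Fintype.card_embedding_eq, Fintype.card_fin, ← div_pow]
  refine le_trans (pow_le_pow_left₀ (by positivity) ?_ _)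
    (Nat.cast_le.2 (Nat.pow_sub_le_descFactorial n (Fintype.card V)) |>.trans_eq'
      (by push_cast; rfl))
  have : (n : ℝ) ≤ 2 * ((n + 1 - Fintype.card V : ℕ) : ℝ) := by
    exact_mod_cast (by omega : n ≤ 2 * (n + 1 - Fintype.card V))
  linarith

/-- First moment bound: the expected number of weak copies is at most `μ_w`. -/
theorem coinMeasure_real_exists_placement_le (hg : Function.Injective g) {M : ℕ} {p : ℕ → I}
    (hp : ∀ r, M < r → p r = 0) :
    (coinMeasure n p).real {ω | ∃ c ∈ placements g n N, ω ∈ placementEvent c} ≤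
      (n : ℝ) ^ Fintype.card V * ∏ i, pPrime M n p (g i).card := by
  have h : {ω | ∃ c ∈ placements g n N, ω ∈ placementEvent c} =
      ⋃ c ∈ placements g n N, placementEvent c := by ext ω; simp
  rw [h]
  refine (measureReal_biUnion_finset_le _ _).trans ?_
  rw [Finset.sum_congr rfl fun c hc => coinMeasure_real_placementEvent hg p hc]
  exact sum_placements_prod_le hp g n N

/-! ### The second moment of the number of placements -/

theorem coinMeasure_real_placementEvent_inter (hg : Function.Injective g) (p : ℕ → I)
    {c c' : Σ _ : V ↪ Fin n, ι → Finset (Fin n)}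
    (hc : c ∈ placements g n N) (hc' : c' ∈ placements g n N) :
    (coinMeasure n p).real (placementEvent c ∩ placementEvent c') =
      (∏ i, (p (c.2 i).card : ℝ)) *
        ∏ i, if c'.2 i ∈ Finset.univ.image c.2 then 1 else (p (c'.2 i).card : ℝ) := by
  have h := coinMeasure_real_forall_eq_true n p (Finset.univ.image c.2 ∪
    (Finset.univ.filter fun i => c'.2 i ∉ Finset.univ.image c.2).image c'.2)
  rw [Finset.prod_union, Finset.prod_image (injective_of_mem_placements hg hc).injOn,
    Finset.prod_image (injective_of_mem_placements hg hc').injOn, Finset.prod_filter] at h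
  · simp only [ite_not] at h
    rw [← h]
    congr 1
    ext ω
    simp only [placementEvent, Set.mem_inter_iff, Set.mem_ofPred_eq, Finset.mem_union,
      Finset.mem_image, Finset.mem_filter, Finset.mem_univ, true_and]
    constructor
    · rintro ⟨h1, h2⟩ s (⟨i, rfl⟩ | ⟨i, -, rfl⟩)
      exacts [h1 i, h2 i]
    · refine fun h => ⟨fun i => h _ (.inl ⟨i, rfl⟩), fun i => ?_⟩
      by_cases hi : ∃ j, c.2 j = c'.2 i
      exacts [h _ (.inl hi), h _ (.inr ⟨i, hi, rfl⟩)]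
  · rw [Finset.disjoint_right]
    simp only [Finset.mem_image, Finset.mem_filter, Finset.mem_univ, true_and]
    rintro _ ⟨i, hi, rfl⟩
    exact hi

variable [DecidableEq V]

theorem card_embedding_filter_le (U : Finset V) (W : Finset (Fin n)) :
    (Finset.univ.filter fun φ : V ↪ Fin n => ∀ v ∈ U, φ v ∈ W).card ≤
      W.card ^ U.card * n ^ Uᶜ.card := by
  calc _ ≤ (Fintype.piFinset fun v => if v ∈ U then W else Finset.univ).card := by
        refine Finset.card_le_card_of_injOn (fun φ => (φ : V → Fin n)) ?_
          DFunLike.coe_injective.injOn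
        intro φ hφ
        simp only [Finset.coe_filter, Finset.mem_univ, true_and, Set.mem_ofPred_eq] at hφ
        simp only [SetLike.mem_coe, Fintype.mem_piFinset]
        intro v
        split_ifs with hv
        exacts [hφ v hv, Finset.mem_univ _]
    _ = _ := by
        rw [Fintype.card_piFinset, ← Finset.prod_mul_prod_compl U]
        congr 1
        · rw [Finset.prod_congr rfl fun v hv => by rw [if_pos hv], Finset.prod_const]
        · rw [Finset.prod_congr rfl fun v hv => by rw [if_neg (Finset.mem_compl.1 hv)],
            Finset.prod_const, Finset.card_univ, Fintype.card_fin]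

/-- The weight of the placements whose sets with indices in `F` belong to a given family `S`, and
no others. Their vertices in `⋃ i ∈ F, g i` land in the bounded set `⋃ S`, which costs a factor `n`
for each of these vertices. -/
theorem sum_placements_overlap_le {M : ℕ} {p : ℕ → I} (hp : ∀ r, M < r → p r = 0)
    (S : Finset (Finset (Fin n))) (F : Finset ι) :
    ∑ c ∈ (placements g n N).filter (fun c => Finset.univ.filter (fun i => c.2 i ∈ S) = F),
        ∏ i, (if c.2 i ∈ S then 1 else (p (c.2 i).card : ℝ)) ≤
      ((S.biUnion id).card ^ (F.biUnion g).card * S.card ^ F.card : ℝ) *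
        ((n : ℝ) ^ (F.biUnion g)ᶜ.card * ∏ i ∈ Fᶜ, pPrime M n p (g i).card) := by
  set w : (i : ι) → Finset (Fin n) → ℝ := fun i e => if i ∈ F then 1 else (p e.card : ℝ) with hw
  have hw0 : ∀ i e, 0 ≤ w i e := fun i e => by
    simp only [hw]; split_ifs; exacts [zero_le_one, (p e.card).2.1]
  set T : Finset (Σ _ : V ↪ Fin n, ι → Finset (Fin n)) :=
    (Finset.univ.filter fun φ : V ↪ Fin n => ∀ v ∈ F.biUnion g, φ v ∈ S.biUnion id).sigma
      fun φ => Fintype.piFinset fun i =>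
        if i ∈ F then S else Finset.univ.filter fun e => (g i).map φ ⊆ e with hT
  have hF : ∀ c : (Σ _ : V ↪ Fin n, ι → Finset (Fin n)),
      Finset.univ.filter (fun i => c.2 i ∈ S) = F → ∀ i, c.2 i ∈ S ↔ i ∈ F := by
    rintro c rfl i; simp
  calc _ = ∑ c ∈ (placements g n N).filter
          (fun c => Finset.univ.filter (fun i => c.2 i ∈ S) = F), ∏ i, w i (c.2 i) := by
        refine Finset.sum_congr rfl fun c hc => Finset.prod_congr rfl fun i _ => ?_
        simp only [hw, hF c (Finset.mem_filter.1 hc).2 i]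
    _ ≤ ∑ c ∈ T, ∏ i, w i (c.2 i) := by
        refine Finset.sum_le_sum_of_subset_of_nonneg ?_
          fun c _ _ => Finset.prod_nonneg fun i _ => hw0 _ _
        intro c hc
        obtain ⟨hc, hcF⟩ := Finset.mem_filter.1 hc
        have hcF := hF c hcF
        simp only [hT, Finset.mem_sigma, Finset.mem_filter, Finset.mem_univ, true_and,
          Fintype.mem_piFinset, Finset.mem_biUnion, id]
        refine ⟨?_, fun i => ?_⟩
        · rintro v ⟨i, hi, hv⟩
          exact ⟨c.2 i, (hcF i).2 hi,
            map_subset_of_mem_placements hc i (Finset.mem_map_of_mem _ hv)⟩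
        · split_ifs with hi
          · exact (hcF i).2 hi
          · simpa using map_subset_of_mem_placements hc i
    _ ≤ ∑ _φ ∈ Finset.univ.filter (fun φ : V ↪ Fin n => ∀ v ∈ F.biUnion g, φ v ∈ S.biUnion id),
          (S.card ^ F.card : ℝ) * ∏ i ∈ Fᶜ, pPrime M n p (g i).card := by
        rw [hT, Finset.sum_sigma]
        refine Finset.sum_le_sum fun φ _ => ?_
        dsimp only
        rw [← Finset.prod_univ_sum, ← Finset.prod_mul_prod_compl F]
        refine mul_le_mul (le_of_eq ?_) ?_ (Finset.prod_nonneg fun i _ =>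
          Finset.sum_nonneg fun e _ => hw0 _ _) (by positivity)
        · rw [← Finset.prod_const]
          refine Finset.prod_congr rfl fun i hi => ?_
          simp [hw, hi]
        · refine Finset.prod_le_prod (fun i _ => Finset.sum_nonneg fun e _ => hw0 _ _)
            fun i hi => ?_
          have hi := Finset.mem_compl.1 hi
          simp only [hw, if_neg hi]
          rw [← Finset.card_map φ]
          exact sum_superset_le_pPrime hp _
    _ ≤ _ := by
        rw [Finset.sum_const, nsmul_eq_mul]
        have h1 : ((Finset.univ.filter fun φ : V ↪ Fin n =>
            ∀ v ∈ F.biUnion g, φ v ∈ S.biUnion id).card : ℝ) ≤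
            ((S.biUnion id).card : ℝ) ^ (F.biUnion g).card * (n : ℝ) ^ (F.biUnion g)ᶜ.card := by
          exact_mod_cast card_embedding_filter_le (F.biUnion g) (S.biUnion id)
        have h2 : (0 : ℝ) ≤ (S.card ^ F.card : ℝ) * ∏ i ∈ Fᶜ, pPrime M n p (g i).card :=
          mul_nonneg (by positivity) (Finset.prod_nonneg fun i _ => pPrime_nonneg _ _ _ _)
        refine (mul_le_mul_of_nonneg_right h1 h2).trans_eq ?_
        ring

/-- The quantity `μ_w` of the subhypergraph formed by the edges with indices in `F` and the vertices
that they cover. -/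
noncomputable def coveredWeight (g : ι → Finset V) (M n : ℕ) (p : ℕ → I) (F : Finset ι) : ℝ :=
  (n : ℝ) ^ (F.biUnion g).card * ∏ i ∈ F, pPrime M n p (g i).card

theorem coveredWeight_mul_compl (g : ι → Finset V) (M n : ℕ) (p : ℕ → I) (F : Finset ι) :
    coveredWeight g M n p F *
        ((n : ℝ) ^ (F.biUnion g)ᶜ.card * ∏ i ∈ Fᶜ, pPrime M n p (g i).card) =
      (n : ℝ) ^ Fintype.card V * ∏ i, pPrime M n p (g i).card := by
  rw [← Finset.prod_mul_prod_compl F, ← Finset.card_add_card_compl (F.biUnion g), pow_add,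
    coveredWeight]
  ring

/-- A placement is determined up to boundedly many choices on the part where it shares sets with a
fixed placement `c`, so the conditional expectation of the number of placements that occur, given
that `c` occurs, exceeds the unconditional one by little. -/
theorem sum_placements_given_le {M : ℕ} {p : ℕ → I} (hp : ∀ r, M < r → p r = 0)
    {c : Σ _ : V ↪ Fin n, ι → Finset (Fin n)} (hc : c ∈ placements g n M)
    (hpos : ∀ F : Finset ι, F.Nonempty → 0 < coveredWeight g M n p F) :
    ∑ c' ∈ placements g n M,
        ∏ i, (if c'.2 i ∈ Finset.univ.image c.2 then 1 else (p (c'.2 i).card : ℝ)) ≤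
      ∑ c' ∈ placements g n M, ∏ i, (p (c'.2 i).card : ℝ) +
        ((Fintype.card ι * (M + 1) + 1 : ℕ) : ℝ) ^ (Fintype.card V + Fintype.card ι) *
          ((n : ℝ) ^ Fintype.card V * ∏ i, pPrime M n p (g i).card) *
          ∑ F ∈ Finset.univ.filter (fun F : Finset ι => F.Nonempty),
            (coveredWeight g M n p F)⁻¹ := by
  set S := Finset.univ.image c.2 with hS
  -- `K` bounds both the number of sets of `c` and the number of labelled vertices they cover.
  set K : ℕ := Fintype.card ι * (M + 1) + 1 with hK
  have hS1 : S.card ≤ Fintype.card ι := Finset.card_image_le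
  have hSK : S.card ≤ K := by nlinarith
  have hSU : (S.biUnion id).card ≤ K := by
    have : (S.biUnion id).card ≤ S.card * M := by
      refine Finset.card_biUnion_le_card_mul _ _ _ fun e he => ?_
      obtain ⟨i, -, rfl⟩ := Finset.mem_image.1 he
      exact (mem_placements.1 hc i).2
    nlinarith [Nat.mul_le_mul_right M hS1]
  rw [← Finset.sum_fiberwise (s := placements g n M)
    (g := fun c' => Finset.univ.filter fun i => c'.2 i ∈ S),
    ← Finset.sum_filter_add_sum_filter_not Finset.univ (fun F : Finset ι => ¬ F.Nonempty)]
  simp only [not_not]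
  refine add_le_add ?_ ?_
  · rw [show (Finset.univ.filter fun F : Finset ι => ¬ F.Nonempty) = {∅} by
      ext F; simp [Finset.not_nonempty_iff_eq_empty], Finset.sum_singleton]
    calc _ = ∑ c' ∈ (placements g n M).filter
            (fun c' => Finset.univ.filter (fun i => c'.2 i ∈ S) = ∅),
            ∏ i, (p (c'.2 i).card : ℝ) := by
          refine Finset.sum_congr rfl fun c' hc' => Finset.prod_congr rfl fun i _ => ?_
          have h := Finset.filter_eq_empty_iff.1 (Finset.mem_filter.1 hc').2 (Finset.mem_univ i)
          rw [if_neg h]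
      _ ≤ _ := Finset.sum_le_sum_of_subset_of_nonneg (Finset.filter_subset _ _)
          fun c' _ _ => Finset.prod_nonneg fun i _ => (p _).2.1
  · rw [Finset.mul_sum]
    refine Finset.sum_le_sum fun F hF => ?_
    have hF := hpos F (Finset.mem_filter.1 hF).2
    refine (sum_placements_overlap_le hp S F).trans ?_
    rw [← coveredWeight_mul_compl g M n p F, mul_assoc _ (coveredWeight g M n p F * _),
      mul_right_comm (coveredWeight g M n p F), mul_inv_cancel₀ hF.ne', one_mul]
    refine mul_le_mul_of_nonneg_right ?_ (mul_nonneg (by positivity)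
      (Finset.prod_nonneg fun i _ => pPrime_nonneg _ _ _ _))
    have hK1 : 1 ≤ K := by omega
    have : (S.biUnion id).card ^ (F.biUnion g).card * S.card ^ F.card ≤
        K ^ (Fintype.card V + Fintype.card ι) := by
      rw [pow_add]
      exact Nat.mul_le_mul
        ((Nat.pow_le_pow_left hSU _).trans (Nat.pow_le_pow_right hK1 (Finset.card_le_univ _)))
        ((Nat.pow_le_pow_left hSK _).trans (Nat.pow_le_pow_right hK1 (Finset.card_le_univ _)))
    exact_mod_cast this

/-- Second moment bound: a bounded multiple of `∑ 1 / μ_w`, over the nonempty sets of edges, bounds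
the probability that there is no weak copy. -/
theorem coinMeasure_real_forall_notMem_placement_le (hg : Function.Injective g) {M : ℕ} {p : ℕ → I}
    (hp : ∀ r, M < r → p r = 0) (hn : 2 * (Fintype.card V + M) ≤ n)
    (hall : 0 < (n : ℝ) ^ Fintype.card V * ∏ i, pPrime M n p (g i).card)
    (hpos : ∀ F : Finset ι, F.Nonempty → 0 < coveredWeight g M n p F) :
    (coinMeasure n p).real {ω | ∀ c ∈ placements g n M, ω ∉ placementEvent c} ≤
      ((Fintype.card ι * (M + 1) + 1 : ℕ) : ℝ) ^ (Fintype.card V + Fintype.card ι) *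
        (2 ^ Fintype.card V * (2 ^ M * M.factorial) ^ Fintype.card ι) *
        ∑ F ∈ Finset.univ.filter (fun F : Finset ι => F.Nonempty),
          (coveredWeight g M n p F)⁻¹ := by
  set μ : ℝ := (n : ℝ) ^ Fintype.card V * ∏ i, pPrime M n p (g i).card with hμ
  set R : ℝ := ∑ F ∈ Finset.univ.filter (fun F : Finset ι => F.Nonempty),
    (coveredWeight g M n p F)⁻¹ with hR
  set m : ℝ := ∑ c ∈ placements g n M, ∏ i, (p (c.2 i).card : ℝ) with hm
  set B : ℝ := ((Fintype.card ι * (M + 1) + 1 : ℕ) : ℝ) ^ (Fintype.card V + Fintype.card ι)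
  set L : ℝ := 2 ^ Fintype.card V * (2 ^ M * M.factorial) ^ Fintype.card ι with hL
  have hL0 : 0 < L := by positivity
  have hmL : μ / L ≤ m := le_sum_placements_prod p g hn
  have hm0 : 0 < m := (div_pos hall hL0).trans_le hmL
  have hR0 : 0 ≤ R := Finset.sum_nonneg fun F hF =>
    (inv_pos.2 (hpos F (Finset.mem_filter.1 hF).2)).le
  have hpair : ∑ c ∈ placements g n M, ∑ c' ∈ placements g n M,
      (coinMeasure n p).real (placementEvent c ∩ placementEvent c') ≤
      m ^ 2 + m * (B * μ * R) := by
    calc _ ≤ ∑ c ∈ placements g n M, (∏ i, (p (c.2 i).card : ℝ)) * (m + B * μ * R) := by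
          refine Finset.sum_le_sum fun c hc => ?_
          rw [Finset.sum_congr rfl fun c' hc' =>
            coinMeasure_real_placementEvent_inter hg p hc hc', ← Finset.mul_sum]
          exact mul_le_mul_of_nonneg_left (sum_placements_given_le hp hc hpos)
            (Finset.prod_nonneg fun i _ => (p _).2.1)
      _ = m ^ 2 + m * (B * μ * R) := by rw [← Finset.sum_mul]; ring
  have h := sq_mul_measureReal_forall_notMem_le (coinMeasure n p) (placements g n M)
    placementEvent (fun c => (Set.toFinite _).measurableSet)
    (Finset.sum_congr rfl fun c hc => coinMeasure_real_placementEvent hg p hc) hpair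
  have h2 : m * (coinMeasure n p).real {ω | ∀ c ∈ placements g n M, ω ∉ placementEvent c} ≤
      B * μ * R := by
    refine le_of_mul_le_mul_left ?_ hm0
    rw [← mul_assoc, ← sq]
    exact h
  have hP : 0 ≤ (coinMeasure n p).real {ω | ∀ c ∈ placements g n M, ω ∉ placementEvent c} :=
    measureReal_nonneg
  refine le_of_mul_le_mul_left ?_ (div_pos hall hL0)
  refine (mul_le_mul_of_nonneg_right hmL hP).trans (h2.trans_eq ?_)
  field_simp

end Hypergraph

/-! ### Weak copies as placements -/

namespace Hypergraph

theorem ContainsWeakCopy.exists_injective {α β : Type*} {G : Hypergraph β} {H : Hypergraph α}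
    (h : G.ContainsWeakCopy H) :
    ∃ φ : H.vertexSet → β, Function.Injective φ ∧
      ∀ s : Set H.vertexSet, Subtype.val '' s ∈ H.edgeSet →
        ∃ e ∈ G.edgeSet, e ∩ Set.range φ = φ '' s := by
  obtain ⟨K, hK, ψ, hψ⟩ := h
  refine ⟨fun v => (ψ v : β), Subtype.val_injective.comp ψ.injective, fun s hs => ?_⟩
  obtain ⟨⟨e, he, h⟩, -⟩ := hK.2 ((hψ s).1 hs)
  have hr : Set.range (fun v => (ψ v : β)) = K.vertexSet := by
    rw [← Function.comp_def, Set.range_comp, ψ.range_eq_univ, Set.image_univ, Subtype.range_coe]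
  exact ⟨e, he, by rw [hr, ← h, Set.image_image]⟩

theorem containsWeakCopy_of_injective {α β : Type*} {G : Hypergraph β} {H : Hypergraph α}
    (hempty : ∅ ∉ H.edgeSet) {φ : H.vertexSet → β} (hφ : Function.Injective φ)
    (hG : Set.range φ ⊆ G.vertexSet)
    (h : ∀ s : Set H.vertexSet, Subtype.val '' s ∈ H.edgeSet →
      ∃ e ∈ G.edgeSet, e ∩ Set.range φ = φ '' s) : G.ContainsWeakCopy H := by
  refine ⟨⟨Set.range φ,
      {e | ∃ s : Set H.vertexSet, Subtype.val '' s ∈ H.edgeSet ∧ e = φ '' s}, ?_⟩,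
    ⟨hG, ?_⟩, Equiv.ofInjective φ hφ, fun s => ?_⟩
  · rintro _ ⟨s, -, rfl⟩
    exact Set.image_subset_range _ _
  · rintro _ ⟨s, hs, rfl⟩
    obtain ⟨e, he, h'⟩ := h s hs
    refine ⟨⟨e, he, h'.symm⟩, fun h0 => hempty ?_⟩
    rw [Set.mem_singleton_iff, Set.image_eq_empty] at h0
    rwa [h0, Set.image_empty] at hs
  · have hi : Subtype.val '' (Equiv.ofInjective φ hφ '' s) = φ '' s := by
      rw [Set.image_image]; rfl
    rw [hi]
    refine ⟨fun hs => ⟨s, hs, rfl⟩, ?_⟩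
    rintro ⟨t, ht, hst⟩
    rwa [hφ.image_injective hst]

/-- The edges of a hypergraph, as finite sets of elements of the subtype of its vertices. -/
def EdgeIndex {α : Type*} (H : Hypergraph α) : Type _ :=
  {s : Finset H.vertexSet // Subtype.val '' (s : Set H.vertexSet) ∈ H.edgeSet}

/-- The set of vertices in the edge with a given index. -/
def EdgeIndex.verts {α : Type*} {H : Hypergraph α} (i : H.EdgeIndex) : Finset H.vertexSet := i.1

theorem EdgeIndex.verts_injective {α : Type*} {H : Hypergraph α} :
    Function.Injective (EdgeIndex.verts (H := H)) := Subtype.val_injective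

theorem EdgeIndex.verts_nonempty {α : Type*} {H : Hypergraph α} (hempty : ∅ ∉ H.edgeSet)
    (i : H.EdgeIndex) : i.verts.Nonempty := by
  rw [Finset.nonempty_iff_ne_empty]
  intro h
  have := i.2
  rw [show i.1 = ∅ from h] at this
  simp [hempty] at this

theorem edgeSet_eq_range_verts {α : Type*} {H : Hypergraph α} (hfin : H.vertexSet.Finite) :
    H.edgeSet = Set.range fun i : H.EdgeIndex => Subtype.val '' (i.verts : Set H.vertexSet) := by
  have := hfin.to_subtype
  ext e
  constructor
  · intro he
    have h : Subtype.val '' ((Set.toFinite (Subtype.val ⁻¹' e : Set H.vertexSet)).toFinset :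
        Set H.vertexSet) = e := by
      rw [Set.Finite.coe_toFinset, Subtype.image_preimage_coe,
        Set.inter_eq_right.2 (H.subset_vertexSet_of_mem_edgeSet' he)]
    exact ⟨⟨_, h.symm ▸ he⟩, h⟩
  · rintro ⟨i, rfl⟩
    exact i.2

/-- A weak copy of `H` restricts to a weak copy of each strong subhypergraph `H'` of `H`. -/
theorem exists_placement_of_containsWeakCopy {α : Type*} {H H' : Hypergraph α}
    (hsub : H'.IsStrongSubhypergraph H) [Fintype H'.vertexSet] [Fintype H'.EdgeIndex]
    [DecidableEq H'.EdgeIndex] {n : ℕ} {ω : Finset (Fin n) → Bool}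
    (h : (random n ω).ContainsWeakCopy H) :
    ∃ c ∈ placements (EdgeIndex.verts (H := H')) n n, ω ∈ placementEvent c := by
  obtain ⟨φ, hφ, h⟩ := h.exists_injective
  let φ' : H'.vertexSet ↪ Fin n :=
    ⟨fun v => φ (Set.inclusion hsub.1 v), hφ.comp (Set.inclusion_injective hsub.1)⟩
  have h' : ∀ i : H'.EdgeIndex, ∃ e : Finset (Fin n), ω e = true ∧
      e ∩ Finset.univ.map φ' = i.verts.map φ' := by
    intro i
    obtain ⟨_, ⟨e, -, he, rfl⟩, h1⟩ := h (Set.inclusion hsub.1 '' i.1) (by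
      rw [Set.image_image]
      exact hsub.2 i.2)
    refine ⟨e, he, ?_⟩
    rw [← Finset.coe_inj, Finset.coe_inter, Finset.coe_map, Finset.coe_map, Finset.coe_univ,
      Set.image_univ]
    have h2 : Set.range φ' ⊆ Set.range φ := by
      rintro _ ⟨v, rfl⟩
      exact ⟨_, rfl⟩
    have h3 : φ '' (Set.inclusion hsub.1 '' i.1) = φ' '' i.verts := by
      rw [Set.image_image]; rfl
    rw [← Set.inter_eq_right.2 h2, ← Set.inter_assoc, h1, h3]
    exact Set.inter_eq_left.2 (Set.image_subset_range _ _)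
  choose e he h' using h'
  exact ⟨⟨φ', e⟩, mem_placements.2 fun i => ⟨h' i, (Finset.card_le_univ _).trans (by simp)⟩, he⟩

theorem containsWeakCopy_of_mem_placementEvent {α : Type*} {H : Hypergraph α}
    (hempty : ∅ ∉ H.edgeSet) [Fintype H.vertexSet] [Fintype H.EdgeIndex]
    [DecidableEq H.EdgeIndex] {n N : ℕ} {ω : Finset (Fin n) → Bool}
    {c : Σ _ : H.vertexSet ↪ Fin n, H.EdgeIndex → Finset (Fin n)}
    (hc : c ∈ placements (EdgeIndex.verts (H := H)) n N) (hω : ω ∈ placementEvent c) :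
    (random n ω).ContainsWeakCopy H := by
  classical
  refine containsWeakCopy_of_injective hempty c.1.injective (Set.subset_univ _) fun s hs => ?_
  let i : H.EdgeIndex := ⟨s.toFinset, by rwa [Set.coe_toFinset]⟩
  have hi : (i.verts : Set H.vertexSet) = s := Set.coe_toFinset s
  have h1 := (mem_placements.1 hc i).1
  refine ⟨c.2 i, ⟨c.2 i, ?_, hω i, rfl⟩, ?_⟩
  · exact ((EdgeIndex.verts_nonempty hempty i).map (f := c.1)).mono
      (map_subset_of_mem_placements hc i)
  · rw [← Finset.coe_inj, Finset.coe_inter, Finset.coe_map, Finset.coe_map, Finset.coe_univ,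
      Set.image_univ, hi] at h1
    exact h1

theorem muW_eq {α V ι : Type*} {g : ι → Finset V} (hg : Function.Injective g)
    (hg0 : ∀ i, (g i).Nonempty) {f : V → α} (hf : Function.Injective f) {K : Hypergraph α}
    {U : Finset V} {F : Finset ι} (hV : K.vertexSet = f '' U)
    (hE : K.edgeSet = (fun i => f '' (g i : Set V)) '' F) (M n : ℕ) (p : ℕ → I) :
    muW M n p K = (n : ℝ) ^ U.card * ∏ i ∈ F, pPrime M n p (g i).card := by
  classical
  have hcard : ∀ W : Finset V, (f '' (W : Set V)).ncard = W.card := fun W => by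
    rw [Set.ncard_image_of_injective _ hf, Set.ncard_coe_finset]
  have hv : K.numVertices = U.card := by rw [numVertices, hV, hcard]
  have hinj : Function.Injective fun i => f '' (g i : Set V) := fun i j h =>
    hg (Finset.coe_injective (hf.image_injective h))
  have he : ∀ r, K.numEdges r = (F.filter fun i => (g i).card = r).card := by
    intro r
    have : {e ∈ K.edgeSet | e.ncard = r} =
        (fun i => f '' (g i : Set V)) '' (F.filter fun i => (g i).card = r : Finset ι) := by
      ext e
      rw [hE]
      constructor
      · rintro ⟨⟨i, hi, rfl⟩, h⟩
        exact ⟨i, by simpa using ⟨hi, (hcard (g i)).symm.trans h⟩, rfl⟩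
      · rintro ⟨i, hi, rfl⟩
        simp only [Finset.coe_filter, Set.mem_ofPred_eq] at hi
        exact ⟨⟨i, hi.1, rfl⟩, (hcard (g i)).trans hi.2⟩
    rw [numEdges, this, Set.ncard_image_of_injective _ hinj, Set.ncard_coe_finset]
  rw [muW, hv, ← Finset.prod_fiberwise_of_maps_to (s := F) (t := Finset.Icc 1 U.card)
    (g := fun i => (g i).card)]
  · congr 1
    refine Finset.prod_congr rfl fun r _ => ?_
    rw [he, ← Finset.prod_const]
    exact Finset.prod_congr rfl fun i hi => by rw [(Finset.mem_filter.1 hi).2]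
  · intro i hi
    refine Finset.mem_Icc.2 ⟨(hg0 i).card_pos, Finset.card_le_card fun v hv => ?_⟩
    have h1 : f '' (g i : Set V) ⊆ K.vertexSet :=
      K.subset_vertexSet_of_mem_edgeSet' (hE ▸ Set.mem_image_of_mem _ hi)
    rw [hV] at h1
    simpa using (Set.image_subset_image_iff hf).1 h1 hv

theorem muW_eq_univ {α : Type*} {H : Hypergraph α} (hempty : ∅ ∉ H.edgeSet)
    [Fintype H.vertexSet] [Fintype H.EdgeIndex] (M n : ℕ) (p : ℕ → I) :
    muW M n p H = (n : ℝ) ^ Fintype.card H.vertexSet *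
      ∏ i : H.EdgeIndex, pPrime M n p i.verts.card :=
  muW_eq EdgeIndex.verts_injective (EdgeIndex.verts_nonempty hempty) Subtype.val_injective
    (U := Finset.univ) (by simp)
    (by simp [edgeSet_eq_range_verts (H := H) (Set.toFinite _)]) M n p

/-- The strong subhypergraph formed by a set of edges and the vertices that they cover. -/
def covered {α : Type*} (H : Hypergraph α) [DecidableEq H.vertexSet] (F : Finset H.EdgeIndex) :
    Hypergraph α where
  vertexSet := Subtype.val '' (F.biUnion EdgeIndex.verts : Set H.vertexSet)
  edgeSet := (fun i : H.EdgeIndex => Subtype.val '' (i.verts : Set H.vertexSet)) '' F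
  subset_vertexSet_of_mem_edgeSet' := by
    rintro _ ⟨i, hi, rfl⟩
    exact Set.image_mono (Finset.coe_subset.2 (Finset.subset_biUnion_of_mem _ hi))

theorem covered_isStrongSubhypergraph {α : Type*} (H : Hypergraph α) [DecidableEq H.vertexSet]
    (F : Finset H.EdgeIndex) : (H.covered F).IsStrongSubhypergraph H := by
  refine ⟨Subtype.coe_image_subset _ _, ?_⟩
  rintro _ ⟨i, -, rfl⟩
  exact i.2

theorem muW_covered {α : Type*} {H : Hypergraph α} [DecidableEq H.vertexSet]
    (hempty : ∅ ∉ H.edgeSet) (F : Finset H.EdgeIndex) (M n : ℕ) (p : ℕ → I) :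
    muW M n p (H.covered F) = coveredWeight EdgeIndex.verts M n p F :=
  muW_eq EdgeIndex.verts_injective (EdgeIndex.verts_nonempty hempty) Subtype.val_injective
    rfl rfl M n p

/-! ### The threshold theorem -/

theorem holdsAAS_of_tendsto_zero {p : ℕ → ℕ → I} {A : ∀ n : ℕ, Hypergraph (Fin n) → Prop}
    {b : ℕ → ℝ} (hb : Tendsto b atTop (𝓝 0))
    (h : ∀ᶠ n in atTop, (coinMeasure n (p n)).real {ω | ¬ A n (random n ω)} ≤ b n) :
    HoldsAAS p A := by
  have h0 : Tendsto (fun n => (coinMeasure n (p n)).real {ω | ¬ A n (random n ω)}) atTop (𝓝 0) :=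
    squeeze_zero' (Eventually.of_forall fun n => measureReal_nonneg) h hb
  have h1 := h0.const_sub 1
  rw [sub_zero] at h1
  refine h1.congr fun n => ?_
  rw [← probReal_compl_eq_one_sub (Set.toFinite _).measurableSet]
  congr 1
  ext ω
  simp

end Hypergraph

theorem mainTheorem2 {α : Type*} (H : Hypergraph α)
    (hfin : H.vertexSet.Finite) (hne : H.vertexSet.Nonempty) (hempty : ∅ ∉ H.edgeSet)
    (M : ℕ) (p : ℕ → ℕ → unitInterval) (hp : ∀ n r : ℕ, M < r → p n r = 0) :
    ((∃ H' : Hypergraph α, H'.IsStrongSubhypergraph H ∧ H'.vertexSet.Nonempty ∧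
        Tendsto (fun n : ℕ => Hypergraph.muW M n (p n) H') atTop (𝓝 0)) →
      Hypergraph.HoldsAAS p (fun _ G => ¬ G.ContainsWeakCopy H)) ∧
    ((∀ H' : Hypergraph α, H'.IsStrongSubhypergraph H → H'.vertexSet.Nonempty →
        Tendsto (fun n : ℕ => Hypergraph.muW M n (p n) H') atTop atTop) →
      Hypergraph.HoldsAAS p (fun _ G => G.ContainsWeakCopy H)) := by
  classical
  constructor
  · rintro ⟨H', hsub, -, hlim⟩
    have hfin' := hfin.subset hsub.1
    have hempty' : ∅ ∉ H'.edgeSet := fun h => hempty (hsub.2 h)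
    have : Fintype H'.vertexSet := hfin'.fintype
    have : Finite H'.EdgeIndex := Subtype.finite
    have : Fintype H'.EdgeIndex := Fintype.ofFinite _
    refine Hypergraph.holdsAAS_of_tendsto_zero hlim (Eventually.of_forall fun n => ?_)
    rw [Hypergraph.muW_eq_univ hempty']
    refine le_trans (measureReal_mono fun ω hω => ?_)
      (Hypergraph.coinMeasure_real_exists_placement_le (N := n)
        Hypergraph.EdgeIndex.verts_injective (hp n))
    exact Hypergraph.exists_placement_of_containsWeakCopy hsub (not_not.1 hω)
  · intro hlim
    have : Fintype H.vertexSet := hfin.fintype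
    have : Finite H.EdgeIndex := Subtype.finite
    have : Fintype H.EdgeIndex := Fintype.ofFinite _
    have hF : ∀ F : Finset H.EdgeIndex, F.Nonempty → Tendsto
        (fun n => Hypergraph.coveredWeight Hypergraph.EdgeIndex.verts M n (p n) F) atTop atTop := by
      rintro F ⟨i, hi⟩
      simp only [← Hypergraph.muW_covered hempty]
      obtain ⟨v, hv⟩ := Hypergraph.EdgeIndex.verts_nonempty hempty i
      exact hlim _ (H.covered_isStrongSubhypergraph F)
        ⟨v, v, by simpa using ⟨i, hi, hv⟩, rfl⟩
    have hH := hlim H ⟨subset_rfl, subset_rfl⟩ hne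
    simp only [Hypergraph.muW_eq_univ hempty] at hH
    have hR : Tendsto (fun n => ∑ F ∈ Finset.univ.filter (fun F : Finset H.EdgeIndex => F.Nonempty),
        (Hypergraph.coveredWeight Hypergraph.EdgeIndex.verts M n (p n) F)⁻¹) atTop (𝓝 0) := by
      rw [← Finset.sum_const_zero]
      exact tendsto_finsetSum _ fun F h => (hF F (Finset.mem_filter.1 h).2).inv_tendsto_atTop
    have hb := hR.const_mul
      (((Fintype.card H.EdgeIndex * (M + 1) + 1 : ℕ) : ℝ) ^
          (Fintype.card H.vertexSet + Fintype.card H.EdgeIndex) *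
        (2 ^ Fintype.card H.vertexSet * (2 ^ M * M.factorial) ^ Fintype.card H.EdgeIndex))
    rw [mul_zero] at hb
    have hpos : ∀ᶠ n in atTop, ∀ F : Finset H.EdgeIndex, F.Nonempty →
        0 < Hypergraph.coveredWeight Hypergraph.EdgeIndex.verts M n (p n) F := by
      refine eventually_all.2 fun F => ?_
      by_cases h : F.Nonempty
      · filter_upwards [(hF F h).eventually_gt_atTop 0] with n hn _ using hn
      · exact Eventually.of_forall fun n h' => absurd h' h
    refine Hypergraph.holdsAAS_of_tendsto_zero hb ?_
    filter_upwards [hpos, hH.eventually_gt_atTop 0,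
      eventually_ge_atTop (2 * (Fintype.card H.vertexSet + M))] with n hn hall hlarge
    refine le_trans (measureReal_mono ?_)
      (Hypergraph.coinMeasure_real_forall_notMem_placement_le
        Hypergraph.EdgeIndex.verts_injective (hp n) hlarge hall hn)
    exact fun ω hω c hc hc' =>
      hω (Hypergraph.containsWeakCopy_of_mem_placementEvent hempty hc hc')
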